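/- Let $\mathbb F_q$ be a finite field of characteristic different from $2$ and $3$, and let $E: y^2=x^3+ax+b$ be an elliptic curve over $\mathbb F_q$ with point at infinity $O$ such that $E(\mathbb F_q)\cong \mathbb Z_p\oplus\mathbb Z_p$ for a prime $p$. Put $n=p^2-1$, let $P_1,\dots,P_n$ be the rational points of $E$ other than $O$, and let $D=P_1+\cdots+P_n$. Let $1\le k\le n-1$ with $p\mid k$, and let $$C=C_{\mathscr L}(D,kO)=\{(f(P_1),\dots,f(P_n)) : f\in\mathscr L(kO)\}\subseteq\mathbb F_q^n,$$ where $\mathscr L(kO)=\{f\in\mathbb F_q(E)^\times : \operatorname{div}(f)\ge -kO\}\cup\{0\}$. Then $C$ has length $n=p^2-1$ and dimension $k$, its minimum distance is $p^2-k-1$ if $p\neq 2$, and (for every prime $p$, including $p=2$) the minimum-weight codewords of $C$ support a $1$-design: if $d$ is the minimum distance of $C$, every codeword of weight $d$ has a support of size $d$, and there is an integer $\lambda\geq 1$ such that every coordinate position $i\in\{1,\dots,n\}$ lies in exactly $\lambda$ of the distinct supports of the codewords of weight $d$. -/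

import Mathlib

open WithZero

/-- A `t-(v, k, lam)` design with point set `α` and family of blocks `𝓑`: there are `v` points, every
block has `k` points, and every `t`-subset of the point set lies in exactly `lam` blocks.  The
trivial case `lam = 0` (in which no block contains `t` points) is excluded. -/
def IsDesign {α : Type*} [Fintype α] (𝓑 : Set (Finset α)) (t v k lam : ℕ) : Prop :=
  Fintype.card α = v ∧ (∀ B ∈ 𝓑, B.card = k) ∧
    (∀ T : Finset α, T.card = t → {B ∈ 𝓑 | T ⊆ B}.ncard = lam) ∧ 0 < lam

namespace LinearCode

variable {F ι : Type*} [Field F] [DecidableEq F] [Fintype ι]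

/-- The minimum distance of a linear code: the least Hamming weight of a nonzero codeword. -/
noncomputable def minDist (C : Submodule F (ι → F)) : ℕ :=
  sInf {w | ∃ c ∈ C, c ≠ 0 ∧ hammingNorm c = w}

/-- The support of a word. -/
def support (c : ι → F) : Finset ι := {i | c i ≠ 0}

/-- The set of the supports of all codewords of weight `w`. -/
def supports (C : Submodule F (ι → F)) (w : ℕ) : Set (Finset ι) :=
  {S | ∃ c ∈ C, hammingNorm c = w ∧ support c = S}

/-- The minimum-weight codewords of `C` support a `t`-design: the coordinate positions together with
the supports of the codewords of minimum weight `d` form a `t-(n, d, lam)` design for some `lam`,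
`n` being the length of the code. -/
def SupportsDesign (C : Submodule F (ι → F)) (t : ℕ) : Prop :=
  ∃ lam, IsDesign (supports C (minDist C)) t (Fintype.card ι) (minDist C) lam

end LinearCode

/-- A place of a function field `K` over the constant field `F`, given by its normalized discrete
valuation: a valuation of `K`, trivial on `F`, whose values are `0` and all of `exp ℤ`.
Valuations are written multiplicatively, so `v f = exp (-ord f)`: `v f < 1` means that `f` has a
zero and `1 < v f` that `f` has a pole. -/
structure Place (F K : Type*) [Field F] [Field K] [Algebra F K] where
  /-- the normalized valuation -/
  val : Valuation K ℤᵐ⁰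
  trivial_on : ∀ a : F, a ≠ 0 → val (algebraMap F K a) = 1
  surjective : Function.Surjective val

namespace Place

variable {F K : Type*} [Field F] [Field K] [Algebra F K]

lemma val_algebraMap_le_one (v : Place F K) (a : F) : v.val (algebraMap F K a) ≤ 1 := by
  by_cases h : a = 0
  · simp [h]
  · exact (v.trivial_on a h).le

lemma val_smul_le (v : Place F K) (a : F) (f : K) : v.val (a • f) ≤ v.val f := by
  rw [Algebra.smul_def, map_mul]
  exact mul_le_of_le_one_left' (v.val_algebraMap_le_one a)

end Place

/-- The Riemann-Roch space `L(G)` of the divisor `∑ G(v) v`: the functions `f` with `f = 0` or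
`ord_v f ≥ -G(v)` at all places `v`. -/
def riemannRochSpace {F K : Type*} [Field F] [Field K] [Algebra F K] (G : Place F K → ℤ) :
    Submodule F K where
  carrier := {f | ∀ v : Place F K, v.val f ≤ exp (G v)}
  zero_mem' v := by simp
  add_mem' hf hg v := (v.val.map_add _ _).trans (max_le (hf v) (hg v))
  smul_mem' a f hf v := (v.val_smul_le a f).trans (hf v)

namespace EllipticCode

variable {F : Type*} [Field F] (W : WeierstrassCurve.Affine F)

/-- The coordinate function `x` in the function field. -/
noncomputable def xFun : W.FunctionField :=
  algebraMap W.CoordinateRing W.FunctionField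
    (WeierstrassCurve.Affine.CoordinateRing.mk W (Polynomial.C Polynomial.X))

/-- The coordinate function `y` in the function field. -/
noncomputable def yFun : W.FunctionField :=
  algebraMap W.CoordinateRing W.FunctionField
    (WeierstrassCurve.Affine.CoordinateRing.mk W Polynomial.X)

variable {W}

/-- `v` is the place at the rational point `P`: the local coordinates of the plane at `P` vanish
at `v`.  These are `x - x₀, y - y₀` at an affine point `(x₀, y₀)`, and `x / y, 1 / y` at the point
`O = [0 : 1 : 0]` at infinity.  On an elliptic curve there is exactly one such place for every
rational point `P`. -/
def IsPlaceAt (v : Place F W.FunctionField) : W.Point → Prop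
  | .zero => v.val (xFun W / yFun W) < 1 ∧ v.val (1 / yFun W) < 1
  | .some x₀ y₀ _ => v.val (xFun W - algebraMap F W.FunctionField x₀) < 1 ∧
      v.val (yFun W - algebraMap F W.FunctionField y₀) < 1

open Classical in
/-- The rational point `P` as a divisor. -/
noncomputable def pointDivisor (P : W.Point) (v : Place F W.FunctionField) : ℤ :=
  if IsPlaceAt v P then 1 else 0

/-- The function `f` is regular at the rational point `P` and `f(P) = c`, that is, `f - c` vanishes
at `P`. -/
def HasValueAt (f : W.FunctionField) (P : W.Point) (c : F) : Prop :=
  ∀ v : Place F W.FunctionField, IsPlaceAt v P →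
    v.val (f - algebraMap F W.FunctionField c) < 1

/-- The algebraic geometry code `C_L(D, G)`, where `D` is the sum of the rational points `P i`:
the words `(f(P i))_i` with `f ∈ L(G)`. -/
def code {ι : Type*} (P : ι → W.Point) (G : Place F W.FunctionField → ℤ) :
    Submodule F (ι → F) where
  carrier := {c | ∃ f ∈ riemannRochSpace G, ∀ i, HasValueAt f (P i) (c i)}
  zero_mem' := ⟨0, zero_mem _, fun i v _ => by simp⟩
  add_mem' := by
    rintro c d ⟨f, hf, hc⟩ ⟨g, hg, hd⟩
    refine ⟨f + g, add_mem hf hg, fun i v hv => ?_⟩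
    have h := (v.val.map_add (f - algebraMap F _ (c i)) (g - algebraMap F _ (d i))).trans_lt
      (max_lt (hc i v hv) (hd i v hv))
    rwa [show f + g - algebraMap F W.FunctionField ((c + d) i) =
      f - algebraMap F _ (c i) + (g - algebraMap F _ (d i)) by
        rw [Pi.add_apply, map_add]; ring]
  smul_mem' := by
    rintro a c ⟨f, hf, hc⟩
    refine ⟨a • f, Submodule.smul_mem _ a hf, fun i v hv => ?_⟩
    have h := (v.val_smul_le a (f - algebraMap F _ (c i))).trans_lt (hc i v hv)
    rwa [show a • f - algebraMap F W.FunctionField ((a • c) i) =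
      a • (f - algebraMap F _ (c i)) by
        rw [Pi.smul_apply, smul_eq_mul, map_mul, smul_sub, Algebra.smul_def, Algebra.smul_def]]

end EllipticCode

/-!
The code `C` is computed inside the coordinate ring `R = F[x, y]`. Since the cubic is squarefree and
`2 ≠ 0`, the ring `R` is integrally closed, hence a Dedekind domain whose nonzero primes give places
not at infinity; so a function without poles away from `O` lies in `R`. At infinity the order of
`f ∈ R` is minus the degree of its norm to `F[x]` (`val_eq_exp_poleOrder`), and `L(kO)` is the space
of `p + q y` with `2 deg p ≤ k` and `2 deg q + 3 ≤ k` (`mem_riemannRochSpace_iff`), which has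
dimension `k`.

The pole order of `f` is also the dimension of `R / (f)`, while the Chinese remainder theorem gives
dimension `#S` for the quotient of `R` by the product of the maximal ideals of a set `S` of affine
rational points. So a nonzero `f ∈ L(kO)` has at most `k` rational zeros, and if it has exactly `k`,
then the product of their ideals is `(f)`. As the group of rational points embeds into the ideal
class group of `R`, the zero sets of size `k` are precisely the sets of `k` affine rational points
with sum zero (`exists_zeros_eq_iff_sum_eq_zero`).

Hence all nonzero weights are at least `n - k`, and the supports of weight `n - k` are the
complements of the `k`-subsets with sum zero. The group of rational points is a plane over `𝔽_p`,
whose automorphisms permute these subsets and act transitively on the nonzero points; this makes the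
supports a `1`-design as soon as they exist. For `p ≠ 2` they do: a union of `k / p` cosets of a
line sums to zero. For `p = 2`, where `n = 3` and `k = 2`, they do not, and `C` is an MDS code of
minimum distance `2`, in which every pair of positions is a support.
-/

section

open Polynomial WeierstrassCurve.Affine
open scoped nonZeroDivisors

/-! ### The coordinate ring is a Dedekind domain -/

/-- A quotient `u / d` of elements of an integrally closed domain that is integral over it lies in
it. -/
lemma dvd_of_isIntegral_div {A K : Type*} [CommRing A] [IsDomain A] [IsIntegrallyClosed A] [Field K]
    [Algebra A K] [FaithfulSMul A K] {u d : A} (hd : d ≠ 0)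
    (h : IsIntegral A (algebraMap A K u / algebraMap A K d)) : d ∣ u := by
  let := FractionRing.liftAlgebra A K
  have := FractionRing.isScalarTower_liftAlgebra A K
  have h' : IsIntegral A (algebraMap A (FractionRing A) u / algebraMap A (FractionRing A) d) := by
    rw [← isIntegral_algebraMap_iff (algebraMap (FractionRing A) K).injective, map_div₀,
      ← IsScalarTower.algebraMap_apply, ← IsScalarTower.algebraMap_apply]
    exact h
  obtain ⟨w, hw⟩ := IsIntegrallyClosed.isIntegral_iff.mp h'
  refine ⟨w, IsFractionRing.injective A (FractionRing A) ?_⟩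
  rw [map_mul, hw, mul_div_cancel₀]
  simpa using hd

/-- If `g` is squarefree and `d² ∣ b² g`, then `d ∣ b`. -/
lemma dvd_of_sq_dvd_sq_mul_squarefree {A : Type*} [EuclideanDomain A] {g b d : A}
    (hg : Squarefree g) (h : d ^ 2 ∣ b ^ 2 * g) : d ∣ b := by
  classical
  by_cases hd : d = 0
  · subst hd
    rw [zero_pow two_ne_zero, zero_dvd_iff, mul_eq_zero] at h
    rcases h with h | h
    · rw [pow_eq_zero_iff two_ne_zero] at h
      rw [h]
    · exact absurd h hg.ne_zero
  · have hc : EuclideanDomain.gcd d b ≠ 0 := fun h0 => hd (EuclideanDomain.gcd_eq_zero_iff.mp h0).1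
    obtain ⟨x, y, hxy⟩ : ∃ x y, EuclideanDomain.gcd d b = d * x + b * y :=
      ⟨_, _, EuclideanDomain.gcd_eq_gcd_ab d b⟩
    obtain ⟨d', hd'⟩ := EuclideanDomain.gcd_dvd_left d b
    obtain ⟨b', hb'⟩ := EuclideanDomain.gcd_dvd_right d b
    generalize EuclideanDomain.gcd d b = c at *
    have hcop : IsCoprime d' b' := by
      refine ⟨x, y, mul_left_cancel₀ hc ?_⟩
      calc c * (x * d' + y * b') = (c * d') * x + (c * b') * y := by ring
        _ = c * 1 := by rw [← hd', ← hb', ← hxy, mul_one]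
    have h1 : d' ^ 2 ∣ b' ^ 2 * g := by
      rw [hd', hb', mul_pow, mul_pow, mul_assoc] at h
      exact (mul_dvd_mul_iff_left (pow_ne_zero 2 hc)).mp h
    have h2 : d' * d' ∣ g := by
      rw [← sq]
      exact (hcop.pow (m := 2) (n := 2)).dvd_of_dvd_mul_left h1
    have h3 : IsUnit d' := hg d' h2
    rw [hd', hb']
    exact mul_dvd_mul_left c h3.dvd

namespace EllipticCode

section ShortNF

variable {F : Type*} [Field F] (E : WeierstrassCurve.Affine F)

/-- The cubic polynomial `x³ + a₄ x + a₆`, the right-hand side of a short Weierstrass equation. -/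
noncomputable def cubic : F[X] := X ^ 3 + C E.a₄ * X + C E.a₆

lemma mk_Y_mul_mk_Y [E.IsShortNF] :
    CoordinateRing.mk E X * CoordinateRing.mk E X =
      algebraMap F[X] E.CoordinateRing (cubic E) := by
  have h := CoordinateRing.smul_basis_mul_Y (W' := E) 0 1
  simp only [E.a₁_of_isShortNF, E.a₂_of_isShortNF, E.a₃_of_isShortNF] at h
  simpa [cubic, Algebra.smul_def] using h

lemma cubic_squarefree [E.IsElliptic] [E.IsShortNF] : Squarefree (cubic E) := by
  have hΔ : E.Δ ≠ 0 := E.isUnit_Δ.ne_zero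
  rw [E.Δ_of_isShortNF] at hΔ
  set D := 4 * E.a₄ ^ 3 + 27 * E.a₆ ^ 2 with hD
  have hD0 : D ≠ 0 := fun h => hΔ (by rw [h, mul_zero])
  apply Separable.squarefree
  -- the Bézout identity `4a³ + 27b² = (-18 a x + 27 b) g + (6 a x² - 9 b x + 4 a²) g'`
  refine ⟨C D⁻¹ * (C (-18 * E.a₄) * X + C (27 * E.a₆)),
    C D⁻¹ * (C (6 * E.a₄) * X ^ 2 - C (9 * E.a₆) * X + C (4 * E.a₄ ^ 2)), ?_⟩
  have h1 : derivative (cubic E) = 3 * X ^ 2 + C E.a₄ := by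
    simp only [cubic, derivative_add, derivative_X_pow, derivative_C_mul, derivative_X,
      derivative_C, mul_one, add_zero]
    norm_num
    exact map_ofNat C 3
  rw [h1, cubic]
  have h2 : C D⁻¹ * C D = (1 : F[X]) := by rw [← C_mul, inv_mul_cancel₀ hD0, C_1]
  rw [← h2, hD]
  simp only [map_add, map_mul, map_pow, map_neg, map_ofNat]
  ring

lemma polynomial_eq [E.IsShortNF] : E.polynomial = X ^ 2 - C (cubic E) := by
  rw [WeierstrassCurve.Affine.polynomial, cubic, E.a₁_of_isShortNF, E.a₂_of_isShortNF,
    E.a₃_of_isShortNF]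
  simp

/-- The conjugation `y ↦ -y` of the coordinate ring of `y² = x³ + a₄ x + a₆`. -/
noncomputable def conj [E.IsShortNF] : E.CoordinateRing →ₐ[F[X]] E.CoordinateRing :=
  AdjoinRoot.liftAlgHom E.polynomial (Algebra.ofId F[X] E.CoordinateRing)
    (-CoordinateRing.mk E X) (by
      have h := mk_Y_mul_mk_Y E
      have h1 : eval₂ (algebraMap F[X] E.CoordinateRing) (-CoordinateRing.mk E X)
          (X ^ 2 - C (cubic E)) = 0 := by
        rw [eval₂_sub, eval₂_X_pow, eval₂_C, neg_sq, sq, h, sub_self]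
      rw [← polynomial_eq] at h1
      exact h1)

lemma conj_mk_Y [E.IsShortNF] : conj E (CoordinateRing.mk E X) = -CoordinateRing.mk E X :=
  AdjoinRoot.liftAlgHom_root ..

lemma conj_injective [E.IsShortNF] : Function.Injective (conj E) := by
  refine (injective_iff_map_eq_zero _).mpr fun f hf => ?_
  obtain ⟨p, q, rfl⟩ := CoordinateRing.exists_smul_basis_eq f
  rw [map_add, map_smul, map_smul, map_one, conj_mk_Y, smul_neg, ← neg_smul] at hf
  obtain ⟨hp, hq⟩ := CoordinateRing.smul_basis_eq_zero hf
  rw [hp, neg_eq_zero.mp hq]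
  simp

instance : Module.Finite F[X] E.CoordinateRing := .of_basis (CoordinateRing.basis E)

/-- Every element of the function field is `(p + q y) / d` for polynomials `p, q, d` in `x`. -/
lemma exists_eq_div [E.IsShortNF] (f : E.FunctionField) : ∃ (p q d : F[X]), d ≠ 0 ∧
    f = algebraMap E.CoordinateRing E.FunctionField (p • 1 + q • CoordinateRing.mk E X) /
      algebraMap F[X] E.FunctionField d := by
  obtain ⟨a, b, hb, rfl⟩ := IsFractionRing.div_surjective (A := E.CoordinateRing) f
  have hb0 : b ≠ 0 := nonZeroDivisors.ne_zero hb
  have hc : conj E b ≠ 0 := (map_ne_zero_iff _ (conj_injective E)).mpr hb0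
  -- the denominator is made rational by multiplying with its conjugate
  obtain ⟨d, hd⟩ : ∃ d : F[X], b * conj E b = algebraMap F[X] E.CoordinateRing d := by
    obtain ⟨p, q, rfl⟩ := CoordinateRing.exists_smul_basis_eq b
    refine ⟨p ^ 2 - q ^ 2 * cubic E, ?_⟩
    rw [map_add, map_smul, map_smul, map_one, conj_mk_Y, map_sub, map_mul, ← mk_Y_mul_mk_Y]
    simp only [Algebra.smul_def, map_pow]
    ring
  obtain ⟨p, q, hpq⟩ := CoordinateRing.exists_smul_basis_eq (a * conj E b)
  refine ⟨p, q, d, ?_, ?_⟩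
  · rintro rfl
    rw [map_zero] at hd
    exact mul_ne_zero hb0 hc hd
  · rw [hpq, IsScalarTower.algebraMap_apply F[X] E.CoordinateRing E.FunctionField, ← hd, map_mul,
      map_mul, mul_div_mul_right]
    simpa using hc

/-- The coordinate ring of an elliptic curve in short Weierstrass form is integrally closed: the
trace and the norm of an integral element `u + v y` are polynomials, and the cubic is
squarefree. -/
lemma exists_algebraMap_eq_of_isIntegral [E.IsElliptic] [E.IsShortNF] {f : E.FunctionField}
    (hf : IsIntegral E.CoordinateRing f) :
    ∃ r, algebraMap E.CoordinateRing E.FunctionField r = f := by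
  have hF : IsIntegral F[X] f := isIntegral_trans (A := E.CoordinateRing) f hf
  have h2 : (2 : F) ≠ 0 := by
    intro h
    have hΔ : E.Δ ≠ 0 := E.isUnit_Δ.ne_zero
    rw [E.Δ_of_isShortNF] at hΔ
    exact hΔ (by linear_combination (-8 * (4 * E.a₄ ^ 3 + 27 * E.a₆ ^ 2)) * h)
  obtain ⟨p, q, d, hd, rfl⟩ := exists_eq_div E f
  have hd' : algebraMap F[X] E.FunctionField d ≠ 0 := by simpa using hd
  let y : E.FunctionField := algebraMap E.CoordinateRing E.FunctionField (CoordinateRing.mk E X)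
  have hy : y * y = algebraMap F[X] E.FunctionField (cubic E) := by
    rw [← map_mul, mk_Y_mul_mk_Y, ← IsScalarTower.algebraMap_apply]
  let P := algebraMap F[X] E.FunctionField p
  let Q := algebraMap F[X] E.FunctionField q
  let D := algebraMap F[X] E.FunctionField d
  have hpq : algebraMap E.CoordinateRing E.FunctionField (p • 1 + q • CoordinateRing.mk E X) =
      P + Q * y := by
    simp only [P, Q, y, Algebra.smul_def, map_add, map_mul, mul_one,
      ← IsScalarTower.algebraMap_apply]
  let g : E.CoordinateRing →ₐ[F[X]] E.FunctionField :=
    (IsScalarTower.toAlgHom F[X] E.CoordinateRing E.FunctionField).comp (conj E)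
  have hg : Function.Injective g :=
    (IsFractionRing.injective E.CoordinateRing E.FunctionField).comp (conj_injective E)
  have hgy : IsFractionRing.liftAlgHom (K := E.FunctionField) hg y = -y := by
    simp only [y, IsFractionRing.liftAlgHom_apply]
    refine (IsFractionRing.lift_algebraMap hg _).trans ?_
    rw [← map_neg, ← conj_mk_Y]
    rfl
  have hconj : IsIntegral F[X] ((P - Q * y) / D) := by
    have h := hF.map (IsFractionRing.liftAlgHom (K := E.FunctionField) hg)
    rwa [hpq, map_div₀, map_add, map_mul, hgy, AlgHom.commutes, AlgHom.commutes, AlgHom.commutes,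
      mul_neg, ← sub_eq_add_neg] at h
  rw [hpq] at hF
  have htrace : d ∣ p := by
    have h : IsIntegral F[X] (algebraMap F[X] E.FunctionField (C 2 * p) / D) := by
      have h : algebraMap F[X] E.FunctionField (C 2 * p) / D =
          (P + Q * y) / D + (P - Q * y) / D := by
        rw [← add_div, map_mul, C_ofNat, map_ofNat]
        congr 1
        ring
      rw [h]
      exact hF.add hconj
    have := dvd_of_isIntegral_div hd h
    rwa [IsUnit.dvd_mul_left (isUnit_C.mpr h2.isUnit)] at this
  obtain ⟨p', hp'⟩ := htrace
  have hnorm : d ∣ q := by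
    refine dvd_of_sq_dvd_sq_mul_squarefree (cubic_squarefree E) ?_
    refine dvd_of_isIntegral_div (K := E.FunctionField) (pow_ne_zero 2 hd) ?_
    have h1 : IsIntegral F[X] (Q * y / D) := by
      have h : Q * y / D = (P + Q * y) / D - algebraMap F[X] E.FunctionField p' := by
        rw [eq_sub_iff_add_eq, eq_div_iff hd', add_mul, div_mul_cancel₀ _ hd']
        simp only [P, hp', map_mul]
        ring
      rw [h]
      exact hF.sub isIntegral_algebraMap
    have h : algebraMap F[X] E.FunctionField (q ^ 2 * cubic E) /
        algebraMap F[X] E.FunctionField (d ^ 2) = (Q * y / D) ^ 2 := by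
      rw [map_mul, map_pow, map_pow, ← hy]
      ring
    exact h ▸ h1.pow 2
  obtain ⟨q', hq'⟩ := hnorm
  refine ⟨p' • 1 + q' • CoordinateRing.mk E X, ?_⟩
  rw [eq_div_iff hd', hp', hq', mul_smul, mul_smul, ← smul_add, Algebra.smul_def d, map_mul,
    ← IsScalarTower.algebraMap_apply, mul_comm]

instance [E.IsElliptic] [E.IsShortNF] : IsDedekindDomain E.CoordinateRing where
  __ := (inferInstance : IsDomain E.CoordinateRing)
  __ := (isDedekindRing_iff E.CoordinateRing E.FunctionField).mpr
    ⟨inferInstance, .of_isIntegral F[X] E.CoordinateRing, exists_algebraMap_eq_of_isIntegral E⟩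

end ShortNF
end EllipticCode

/-! ### Places at infinity and the Riemann-Roch spaces of multiples of `O` -/

namespace EllipticCode

section PoleOrder

variable {F : Type*} [Field F] {E : WeierstrassCurve.Affine F}

/-- The pole order at the point at infinity of a function that is regular elsewhere, encoded as the
degree of its norm to `F[x]`.  The zero function gets the value `0`. -/
noncomputable def poleOrder (f : E.CoordinateRing) : ℕ := (Algebra.norm F[X] f).natDegree

lemma poleOrder_zero : poleOrder (0 : E.CoordinateRing) = 0 := by
  rw [poleOrder, Algebra.norm_zero, natDegree_zero]

lemma norm_ne_zero {f : E.CoordinateRing} (hf : f ≠ 0) : Algebra.norm F[X] f ≠ 0 :=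
  Algebra.norm_ne_zero_iff.mpr hf

lemma poleOrder_mul {f g : E.CoordinateRing} (hf : f ≠ 0) (hg : g ≠ 0) :
    poleOrder (f * g) = poleOrder f + poleOrder g := by
  rw [poleOrder, map_mul, natDegree_mul (norm_ne_zero hf) (norm_ne_zero hg), poleOrder, poleOrder]

lemma poleOrder_smul_one (p : F[X]) :
    poleOrder (p • 1 : E.CoordinateRing) = 2 * p.natDegree := by
  have h : Algebra.norm F[X] (p • 1 : E.CoordinateRing) = p ^ 2 := by
    simpa using CoordinateRing.norm_smul_basis (W' := E) p 0
  rw [poleOrder, h, natDegree_pow]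

lemma poleOrder_eq_of_right_ne_zero (p : F[X]) {q : F[X]} (hq : q ≠ 0) :
    poleOrder (p • 1 + q • CoordinateRing.mk E X) =
      max (2 * p.natDegree) (2 * q.natDegree + 3) := by
  refine natDegree_eq_of_degree_eq_some ?_
  rw [CoordinateRing.degree_norm_smul_basis, degree_eq_natDegree hq]
  by_cases hp : p = 0
  · simp [hp]
  · rw [degree_eq_natDegree hp]
    simp
    rfl

lemma poleOrder_le_iff (p q : F[X]) (k : ℕ) :
    poleOrder (p • 1 + q • CoordinateRing.mk E X) ≤ k ↔
      2 * p.natDegree ≤ k ∧ (q ≠ 0 → 2 * q.natDegree + 3 ≤ k) := by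
  by_cases hq : q = 0
  · simp [hq, poleOrder_smul_one]
  · rw [poleOrder_eq_of_right_ne_zero p hq]
    simp [hq]

lemma poleOrder_add_le {f g : E.CoordinateRing} {k : ℕ} (hf : poleOrder f ≤ k)
    (hg : poleOrder g ≤ k) : poleOrder (f + g) ≤ k := by
  obtain ⟨p, q, rfl⟩ := CoordinateRing.exists_smul_basis_eq f
  obtain ⟨p', q', rfl⟩ := CoordinateRing.exists_smul_basis_eq g
  rw [poleOrder_le_iff] at hf hg
  rw [add_add_add_comm, ← add_smul, ← add_smul, poleOrder_le_iff]
  have hp := natDegree_add_le p p'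
  have hq := natDegree_add_le q q'
  refine ⟨by omega, fun h => ?_⟩
  by_cases h1 : q = 0
  · subst h1
    rw [zero_add] at h ⊢
    exact hg.2 h
  · by_cases h2 : q' = 0
    · subst h2
      rw [add_zero]
      exact hf.2 h1
    · have := hf.2 h1
      have := hg.2 h2
      omega

open Classical in
/-- The valuation of the coordinate ring given by the pole order at the point at infinity. -/
noncomputable def poleValuation (E : WeierstrassCurve.Affine F) :
    Valuation E.CoordinateRing ℤᵐ⁰ where
  toFun f := if f = 0 then 0 else exp (poleOrder f : ℤ)
  map_zero' := if_pos rfl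
  map_one' := by
    rw [if_neg one_ne_zero, poleOrder, map_one, natDegree_one]
    simp
  map_mul' f g := by
    by_cases hf : f = 0
    · simp [hf]
    by_cases hg : g = 0
    · simp [hg]
    rw [if_neg (mul_ne_zero hf hg), if_neg hf, if_neg hg, poleOrder_mul hf hg, Nat.cast_add,
      exp_add]
  map_add_le_max' f g := by
    by_cases hf : f = 0
    · simp [hf]
    by_cases hg : g = 0
    · simp [hg]
    by_cases hfg : f + g = 0
    · rw [if_pos hfg]
      exact zero_le
    rw [if_neg hfg, if_neg hf, if_neg hg, le_max_iff, exp_le_exp, exp_le_exp, Nat.cast_le,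
      Nat.cast_le, ← le_max_iff]
    exact poleOrder_add_le (le_max_left _ _) (le_max_right _ _)

lemma poleValuation_apply {f : E.CoordinateRing} (hf : f ≠ 0) :
    poleValuation E f = exp (poleOrder f : ℤ) := if_neg hf

lemma nonZeroDivisors_le_primeCompl_supp :
    E.CoordinateRing⁰ ≤ (poleValuation E).supp.primeCompl := by
  intro f hf h
  rw [SetLike.mem_coe, Valuation.mem_supp_iff,
    poleValuation_apply (nonZeroDivisors.ne_zero hf)] at h
  exact exp_ne_zero h

lemma xFun_eq : xFun E = algebraMap F[X] E.FunctionField X := rfl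

lemma mk_Y_ne_zero : CoordinateRing.mk E X ≠ 0 := by
  have := CoordinateRing.YClass_ne_zero (W' := E) 0
  rwa [CoordinateRing.YClass, C_0, sub_zero] at this

lemma poleOrder_mk_Y : poleOrder (CoordinateRing.mk E X) = 3 := by
  have h := poleOrder_eq_of_right_ne_zero (E := E) 0 (one_ne_zero (α := F[X]))
  simpa using h

lemma algebraMap_ne_zero {p : F[X]} (hp : p ≠ 0) : algebraMap F[X] E.CoordinateRing p ≠ 0 :=
  (map_ne_zero_iff _ (FaithfulSMul.algebraMap_injective F[X] E.CoordinateRing)).mpr hp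

lemma poleOrder_algebraMap (p : F[X]) :
    poleOrder (algebraMap F[X] E.CoordinateRing p) = 2 * p.natDegree := by
  rw [Algebra.algebraMap_eq_smul_one, poleOrder_smul_one]

variable (E) in
lemma extended_poleValuation_x : (poleValuation E).extendToLocalization
    nonZeroDivisors_le_primeCompl_supp E.FunctionField (xFun E) = exp 2 := by
  have h : xFun E = algebraMap E.CoordinateRing E.FunctionField (algebraMap F[X] _ X) := rfl
  rw [h, Valuation.extendToLocalization_apply_map_apply, poleValuation_apply
      (algebraMap_ne_zero X_ne_zero),
    poleOrder_algebraMap, natDegree_X]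
  rfl

variable (E) in
lemma extended_poleValuation_y : (poleValuation E).extendToLocalization
    nonZeroDivisors_le_primeCompl_supp E.FunctionField (yFun E) = exp 3 := by
  rw [yFun, Valuation.extendToLocalization_apply_map_apply, poleValuation_apply mk_Y_ne_zero,
    poleOrder_mk_Y]
  rfl

variable (E) in
/-- The place at the point at infinity. -/
noncomputable def placeAtInfinity : Place F E.FunctionField where
  val := (poleValuation E).extendToLocalization nonZeroDivisors_le_primeCompl_supp _
  trivial_on a ha := by
    have h : algebraMap F E.FunctionField a =
        algebraMap E.CoordinateRing E.FunctionField (algebraMap F[X] _ (C a)) := rfl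
    rw [h, Valuation.extendToLocalization_apply_map_apply, poleValuation_apply
        (algebraMap_ne_zero (C_ne_zero.mpr ha)),
      poleOrder_algebraMap, natDegree_C]
    simp
  surjective z := by
    induction z using WithZero.expRecOn with
    | zero => exact ⟨0, map_zero _⟩
    | exp n =>
      refine ⟨(yFun E / xFun E) ^ n, ?_⟩
      rw [map_zpow₀, map_div₀, extended_poleValuation_x, extended_poleValuation_y, ← exp_sub,
        ← exp_zsmul]
      simp

variable (E) in
lemma isPlaceAt_placeAtInfinity : IsPlaceAt (placeAtInfinity E) 0 := by
  have hx : (placeAtInfinity E).val (xFun E) = exp 2 := extended_poleValuation_x E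
  have hy : (placeAtInfinity E).val (yFun E) = exp 3 := extended_poleValuation_y E
  refine ⟨?_, ?_⟩
  · rw [map_div₀, hx, hy, ← exp_sub, ← exp_zero, exp_lt_exp]
    norm_num
  · rw [map_div₀, map_one, hy, ← exp_zero, ← exp_sub, exp_lt_exp]
    norm_num

lemma val_linear_le (v : Place F E.FunctionField) (a b : F) (f : E.FunctionField) :
    v.val (algebraMap F E.FunctionField a * f + algebraMap F E.FunctionField b) ≤
      max (v.val f) 1 := by
  refine (v.val.map_add _ _).trans (max_le_max ?_ (v.val_algebraMap_le_one b))
  rw [map_mul]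
  exact mul_le_of_le_one_left' (v.val_algebraMap_le_one a)

variable [E.IsShortNF]

lemma yFun_sq : yFun E ^ 2 = xFun E ^ 3 + (algebraMap F E.FunctionField E.a₄ * xFun E +
    algebraMap F E.FunctionField E.a₆) := by
  rw [sq, yFun, ← map_mul, mk_Y_mul_mk_Y, ← IsScalarTower.algebraMap_apply, cubic,
    xFun_eq, add_assoc]
  simp only [map_add, map_mul, map_pow]
  rfl

lemma val_y_sq_of_one_lt (v : Place F E.FunctionField) (hx : 1 < v.val (xFun E)) :
    v.val (yFun E) ^ 2 = v.val (xFun E) ^ 3 := by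
  rw [← map_pow, yFun_sq, Valuation.map_add_eq_of_lt_left, map_pow]
  refine (val_linear_le v _ _ _).trans_lt ?_
  rw [max_eq_left hx.le, map_pow]
  exact lt_self_pow₀ hx (by norm_num)

lemma val_y_le_one (v : Place F E.FunctionField) (hx : v.val (xFun E) ≤ 1) :
    v.val (yFun E) ≤ 1 := by
  rw [← pow_le_one_iff_of_nonneg zero_le two_ne_zero, ← map_pow, yFun_sq]
  refine (v.val.map_add _ _).trans (max_le ?_ ((val_linear_le v _ _ _).trans (max_le hx le_rfl)))
  rw [map_pow]
  exact pow_le_one₀ zero_le hx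

/-- The places at infinity are the poles of `x`. -/
lemma isPlaceAt_zero_iff (v : Place F E.FunctionField) :
    IsPlaceAt v (0 : E.Point) ↔ 1 < v.val (xFun E) := by
  constructor
  · rintro ⟨-, h⟩
    by_contra! hx
    have hy := val_y_le_one v hx
    have hy0 : v.val (yFun E) ≠ 0 := by
      rw [Valuation.ne_zero_iff]
      simpa [yFun] using mk_Y_ne_zero
    rw [map_div₀, map_one, one_div] at h
    exact absurd h (not_lt.mpr ((one_le_inv₀ (zero_lt_iff.mpr hy0)).mpr hy))
  · intro hx
    have hxy := val_y_sq_of_one_lt v hx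
    have h : v.val (xFun E) < v.val (yFun E) := by
      rw [← pow_lt_pow_iff_left₀ zero_le zero_le two_ne_zero, hxy]
      exact pow_lt_pow_right₀ hx (by norm_num)
    have hy : 1 < v.val (yFun E) := hx.trans h
    refine ⟨?_, ?_⟩
    · rw [map_div₀]
      exact (div_lt_one₀ (zero_lt_one.trans hy)).mpr h
    · rw [map_div₀, map_one]
      exact (div_lt_one₀ (zero_lt_one.trans hy)).mpr hy

lemma val_le_one_of_not_isPlaceAt_zero {v : Place F E.FunctionField}
    (hv : ¬ IsPlaceAt v (0 : E.Point)) (f : E.CoordinateRing) :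
    v.val (algebraMap E.CoordinateRing E.FunctionField f) ≤ 1 := by
  rw [isPlaceAt_zero_iff, not_lt] at hv
  have hpoly (p : F[X]) : v.val (algebraMap F[X] E.FunctionField p) ≤ 1 := by
    induction p using Polynomial.induction_on' with
    | add p q hp hq =>
      rw [map_add]
      exact (v.val.map_add _ _).trans (max_le hp hq)
    | monomial n a =>
      rw [← C_mul_X_pow_eq_monomial, map_mul, map_pow, ← xFun_eq, map_mul, map_pow]
      exact mul_le_one₀ (v.val_algebraMap_le_one a) zero_le (pow_le_one₀ zero_le hv)
  obtain ⟨p, q, rfl⟩ := CoordinateRing.exists_smul_basis_eq f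
  rw [Algebra.smul_def, Algebra.smul_def, mul_one, map_add, map_mul,
    ← IsScalarTower.algebraMap_apply, ← IsScalarTower.algebraMap_apply]
  refine (v.val.map_add _ _).trans (max_le (hpoly p) ?_)
  rw [map_mul]
  exact mul_le_one₀ (hpoly q) zero_le (val_y_le_one v hv)

/-- At a place at infinity, the order of a function is determined by its pole order up to a
positive factor `m`, namely half the pole order of `x`. -/
lemma exists_val_eq_exp_mul {v : Place F E.FunctionField} (hv : IsPlaceAt v (0 : E.Point)) :
    ∃ m : ℤ, 0 < m ∧ ∀ f : E.CoordinateRing, f ≠ 0 →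
      v.val (algebraMap E.CoordinateRing E.FunctionField f) = exp (m * poleOrder f) := by
  rw [isPlaceAt_zero_iff] at hv
  have hxy := val_y_sq_of_one_lt v hv
  have hx0 : v.val (xFun E) ≠ 0 := (zero_lt_one.trans hv).ne'
  have hy0 : v.val (yFun E) ≠ 0 := by
    rw [Valuation.ne_zero_iff]
    simpa [yFun] using mk_Y_ne_zero
  obtain ⟨s, hs⟩ : ∃ s, v.val (xFun E) = exp s := ⟨_, (exp_log hx0).symm⟩
  obtain ⟨t, ht⟩ : ∃ t, v.val (yFun E) = exp t := ⟨_, (exp_log hy0).symm⟩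
  have hst : 2 * t = 3 * s := by
    rw [hs, ht, ← exp_nsmul, ← exp_nsmul, exp_inj] at hxy
    simpa using hxy
  have hs0 : 0 < s := by
    rwa [hs, ← exp_zero, exp_lt_exp] at hv
  obtain ⟨m, rfl⟩ : ∃ m, s = 2 * m := ⟨t - s, by omega⟩
  obtain rfl : t = 3 * m := by omega
  have hm : 0 < m := by omega
  have : v.val.IsTrivialOn F := ⟨fun a ha => v.trivial_on a ha⟩
  have hpoly {p : F[X]} (hp : p ≠ 0) :
      v.val (algebraMap F[X] E.FunctionField p) = exp (m * (2 * p.natDegree : ℕ)) := by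
    have h := valuation_aeval_eq_valuation_X_pow_natDegree_of_one_lt_valuation_X
      (v := v.val) (xFun E) hv hp
    have h1 : aeval (xFun E) p = algebraMap F[X] E.FunctionField p := by
      rw [xFun_eq, aeval_algebraMap_apply, aeval_X_left_apply]
    rw [h1, hs, ← exp_nsmul] at h
    rw [h]
    congr 1
    push_cast
    rw [nsmul_eq_mul]
    ring
  refine ⟨m, hm, fun f hf => ?_⟩
  obtain ⟨p, q, rfl⟩ := CoordinateRing.exists_smul_basis_eq f
  by_cases hq : q = 0
  · subst hq
    rw [zero_smul, add_zero] at hf ⊢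
    have hp : p ≠ 0 := by
      rintro rfl
      exact hf (zero_smul _ _)
    rw [poleOrder_smul_one, ← hpoly hp, Algebra.smul_def, mul_one,
      ← IsScalarTower.algebraMap_apply]
  · have hqy : v.val (algebraMap E.CoordinateRing E.FunctionField (q • CoordinateRing.mk E X)) =
        exp (m * (2 * q.natDegree + 3 : ℕ)) := by
      rw [Algebra.smul_def, map_mul, map_mul, ← IsScalarTower.algebraMap_apply, hpoly hq,
        show algebraMap E.CoordinateRing E.FunctionField (CoordinateRing.mk E X) = yFun E from rfl,
        ht, ← exp_add]
      congr 1
      push_cast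
      ring
    have hp1 : v.val (algebraMap E.CoordinateRing E.FunctionField (p • 1)) =
        v.val (algebraMap F[X] E.FunctionField p) := by
      rw [Algebra.smul_def, mul_one, ← IsScalarTower.algebraMap_apply]
    rw [poleOrder_eq_of_right_ne_zero p hq, map_add]
    rcases lt_or_ge (2 * p.natDegree) (2 * q.natDegree + 3) with h | h
    · rw [max_eq_right h.le, Valuation.map_add_eq_of_lt_right, hqy]
      rw [hqy, hp1]
      by_cases hp : p = 0
      · simp [hp]
      · rw [hpoly hp, exp_lt_exp]
        exact mul_lt_mul_of_pos_left (by exact_mod_cast h) hm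
    · have hp : p ≠ 0 := by
        rintro rfl
        simp at h
      rw [max_eq_left h, Valuation.map_add_eq_of_lt_left, hp1, hpoly hp]
      rw [hqy, hp1, hpoly hp, exp_lt_exp]
      refine mul_lt_mul_of_pos_left ?_ hm
      exact_mod_cast (show 2 * q.natDegree + 3 < 2 * p.natDegree by omega)

/-- A place at infinity measures the pole order: it is normalized, which forces the factor in
`exists_val_eq_exp_mul` to be `1`. -/
lemma val_eq_exp_poleOrder {v : Place F E.FunctionField} (hv : IsPlaceAt v (0 : E.Point))
    {f : E.CoordinateRing} (hf : f ≠ 0) :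
    v.val (algebraMap E.CoordinateRing E.FunctionField f) = exp (poleOrder f : ℤ) := by
  obtain ⟨m, hm, h⟩ := exists_val_eq_exp_mul hv
  obtain ⟨z, hz⟩ := v.surjective (exp 1)
  obtain ⟨a, b, hb, rfl⟩ := IsFractionRing.div_surjective (A := E.CoordinateRing) z
  have ha0 : a ≠ 0 := by
    rintro rfl
    rw [map_zero, zero_div, map_zero] at hz
    exact exp_ne_zero hz.symm
  rw [map_div₀, h a ha0, h b (nonZeroDivisors.ne_zero hb), ← exp_sub, exp_inj, ← mul_sub] at hz
  have h1 : m = 1 := Int.eq_one_of_mul_eq_one_right hm.le hz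
  rw [h f hf, h1, one_mul]

end PoleOrder

section RiemannRochSpace

variable {F : Type*} [Field F] {E : WeierstrassCurve.Affine F}

/-- The place of the function field given by a nonzero prime of the coordinate ring. -/
noncomputable def placeOfPrime [E.IsElliptic] [E.IsShortNF]
    (𝔭 : IsDedekindDomain.HeightOneSpectrum E.CoordinateRing) : Place F E.FunctionField where
  val := 𝔭.valuation E.FunctionField
  trivial_on a ha := by
    rw [IsScalarTower.algebraMap_apply F E.CoordinateRing E.FunctionField,
      IsDedekindDomain.HeightOneSpectrum.valuation_eq_one_iff_notMem]
    exact fun h => 𝔭.isPrime.ne_top (Ideal.eq_top_of_isUnit_mem _ h (ha.isUnit.map _))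
  surjective := 𝔭.valuation_surjective E.FunctionField

/-- The Riemann-Roch space of `kO` consists of the elements of the coordinate ring of pole order
at most `k`. -/
lemma mem_riemannRochSpace_iff [E.IsElliptic] [E.IsShortNF] (k : ℕ) (f : E.FunctionField) :
    f ∈ riemannRochSpace (k • pointDivisor (0 : E.Point)) ↔
      ∃ r : E.CoordinateRing, poleOrder r ≤ k ∧
        algebraMap E.CoordinateRing E.FunctionField r = f := by
  constructor
  · intro hf
    obtain ⟨r, rfl⟩ : f ∈ (algebraMap E.CoordinateRing E.FunctionField).range := by
      refine IsDedekindDomain.HeightOneSpectrum.mem_integers_of_valuation_le_one _ f fun 𝔭 => ?_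
      have h := hf (placeOfPrime 𝔭)
      have h0 : ¬ IsPlaceAt (placeOfPrime 𝔭) (0 : E.Point) := by
        rw [isPlaceAt_zero_iff, not_lt]
        exact 𝔭.valuation_le_one _
      rw [Pi.smul_apply, pointDivisor, if_neg h0, smul_zero, exp_zero] at h
      exact h
    refine ⟨r, ?_, rfl⟩
    by_cases hr : r = 0
    · rw [hr, poleOrder_zero]
      exact k.zero_le
    have h := hf (placeAtInfinity E)
    have h0 := isPlaceAt_placeAtInfinity E
    rw [Pi.smul_apply, pointDivisor, if_pos h0, val_eq_exp_poleOrder h0 hr, exp_le_exp] at h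
    simpa using h
  · rintro ⟨r, hr, rfl⟩ v
    by_cases hr0 : r = 0
    · simp [hr0]
    by_cases hv : IsPlaceAt v (0 : E.Point)
    · rw [Pi.smul_apply, pointDivisor, if_pos hv, val_eq_exp_poleOrder hv hr0, exp_le_exp]
      simpa using hr
    · rw [Pi.smul_apply, pointDivisor, if_neg hv, smul_zero, exp_zero]
      exact val_le_one_of_not_isPlaceAt_zero hv r

end RiemannRochSpace

end EllipticCode

/-! ### Evaluation at rational points and zeros of functions -/

namespace EllipticCode

section Evaluation

variable {F : Type*} [Field F] {E : WeierstrassCurve.Affine F}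

/-- Evaluation at an affine solution `(x, y)` of the Weierstrass equation. -/
noncomputable def evalCoord {x y : F} (h : E.Equation x y) : E.CoordinateRing →ₐ[F] F :=
  ((CoordinateRing.quotientXYIdealEquiv (W' := E) (x := x) (y := C y) h :
    (E.CoordinateRing ⧸ CoordinateRing.XYIdeal E x (C y)) ≃ₐ[F] F) :
      (E.CoordinateRing ⧸ CoordinateRing.XYIdeal E x (C y)) →ₐ[F] F).comp
    (Ideal.Quotient.mkₐ F (CoordinateRing.XYIdeal E x (C y)))

lemma evalCoord_eq_zero_iff {x y : F} (h : E.Equation x y) (f : E.CoordinateRing) :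
    evalCoord h f = 0 ↔ f ∈ CoordinateRing.XYIdeal E x (C y) := by
  rw [evalCoord, AlgHom.comp_apply, ← Ideal.Quotient.eq_zero_iff_mem]
  exact map_eq_zero_iff _ (AlgEquiv.injective _)

/-- Evaluation at an affine rational point of the functions that are regular on the affine
curve. -/
noncomputable def evalAt : {Q : E.Point // Q ≠ 0} → E.CoordinateRing →ₐ[F] F
  | ⟨.zero, h⟩ => absurd rfl h
  | ⟨.some _ _ h, _⟩ => evalCoord h.left

lemma evalAt_surjective (Q : {Q : E.Point // Q ≠ 0}) : Function.Surjective (evalAt Q) :=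
  fun c => ⟨algebraMap F _ c, (evalAt Q).commutes c⟩

/-- The maximal ideal of the functions vanishing at an affine rational point. -/
noncomputable def pointIdeal (Q : {Q : E.Point // Q ≠ 0}) : Ideal E.CoordinateRing :=
  RingHom.ker (evalAt Q)

lemma mem_pointIdeal {Q : {Q : E.Point // Q ≠ 0}} {f : E.CoordinateRing} :
    f ∈ pointIdeal Q ↔ evalAt Q f = 0 := RingHom.mem_ker

lemma pointIdeal_some {x y : F} (h : E.Nonsingular x y) (h0 : (.some x y h : E.Point) ≠ 0) :
    pointIdeal ⟨.some x y h, h0⟩ = CoordinateRing.XYIdeal E x (C y) := by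
  ext f
  rw [mem_pointIdeal, evalAt, evalCoord_eq_zero_iff]

instance (Q : {Q : E.Point // Q ≠ 0}) : (pointIdeal Q).IsMaximal :=
  RingHom.ker_isMaximal_of_surjective _ (evalAt_surjective Q)

lemma sub_evalAt_mem_pointIdeal (Q : {Q : E.Point // Q ≠ 0}) (f : E.CoordinateRing) :
    f - algebraMap F _ (evalAt Q f) ∈ pointIdeal Q := by
  rw [mem_pointIdeal, map_sub, AlgHom.commutes]
  exact sub_self _

/-- The ideal of an affine rational point as an invertible fractional ideal. -/
noncomputable def pointUnit :
    {Q : E.Point // Q ≠ 0} → (FractionalIdeal E.CoordinateRing⁰ E.FunctionField)ˣ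
  | ⟨.zero, h⟩ => absurd rfl h
  | ⟨.some _ _ h, _⟩ => CoordinateRing.XYIdeal' (W := E) h

lemma coe_pointUnit (Q : {Q : E.Point // Q ≠ 0}) :
    (pointUnit Q : FractionalIdeal E.CoordinateRing⁰ E.FunctionField) = pointIdeal Q := by
  obtain ⟨_ | ⟨x, y, h⟩, h0⟩ := Q
  · exact absurd rfl h0
  · rw [pointIdeal_some, pointUnit, CoordinateRing.XYIdeal'_eq]

variable [DecidableEq F]

lemma toClass_eq_mk_pointUnit (Q : {Q : E.Point // Q ≠ 0}) :
    Point.toClass (Q : E.Point) =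
      Additive.ofMul (ClassGroup.mk E.FunctionField (pointUnit Q)) := by
  obtain ⟨_ | ⟨x, y, h⟩, h0⟩ := Q
  · exact absurd rfl h0
  · rfl

omit [DecidableEq F] in
lemma pointIdeal_injective : Function.Injective (pointIdeal (E := E)) := by
  classical
  intro Q Q' h
  have h1 : pointUnit Q = pointUnit Q' := Units.ext (by rw [coe_pointUnit, coe_pointUnit, h])
  apply Subtype.ext
  apply Point.toClass_injective
  rw [toClass_eq_mk_pointUnit, toClass_eq_mk_pointUnit, h1]

/-- Affine rational points sum to zero if and only if the product of their ideals is principal. -/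
lemma sum_eq_zero_iff (S : Finset {Q : E.Point // Q ≠ 0}) :
    ∑ Q ∈ S, (Q : E.Point) = 0 ↔
      ∃ f : E.CoordinateRing, f ≠ 0 ∧ ∏ Q ∈ S, pointIdeal Q = Ideal.span {f} := by
  have h : ((∏ Q ∈ S, pointUnit Q : (FractionalIdeal E.CoordinateRing⁰ E.FunctionField)ˣ) :
      FractionalIdeal E.CoordinateRing⁰ E.FunctionField) =
        (∏ Q ∈ S, pointIdeal Q : Ideal E.CoordinateRing) := by
    rw [Units.coe_prod]
    simp_rw [coe_pointUnit]
    exact (map_prod (FractionalIdeal.coeIdealHom E.CoordinateRing⁰ E.FunctionField) _ _).symm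
  rw [← ClassGroup.mk_eq_one_of_coe_ideal h, ← map_eq_zero_iff _ Point.toClass_injective, map_sum,
    map_prod, ← ofMul_eq_zero, ofMul_prod]
  simp_rw [toClass_eq_mk_pointUnit]

omit [DecidableEq F] in
lemma isCoprime_pointIdeal {Q Q' : {Q : E.Point // Q ≠ 0}} (h : Q ≠ Q') :
    IsCoprime (pointIdeal Q) (pointIdeal Q') :=
  Ideal.isCoprime_of_isMaximal (pointIdeal_injective.ne h)

omit [DecidableEq F] in
lemma mem_prod_pointIdeal {S : Finset {Q : E.Point // Q ≠ 0}} {f : E.CoordinateRing} :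
    f ∈ ∏ Q ∈ S, pointIdeal Q ↔ ∀ Q ∈ S, evalAt Q f = 0 := by
  rw [Ideal.prod_eq_iInf_of_pairwise_isCoprime fun _ _ _ _ h => isCoprime_pointIdeal h]
  simp [mem_pointIdeal]

omit [DecidableEq F] in
lemma finrank_quotient_prod_pointIdeal (S : Finset {Q : E.Point // Q ≠ 0}) :
    Module.finrank F (E.CoordinateRing ⧸ ∏ Q ∈ S, pointIdeal Q) = S.card := by
  let g : E.CoordinateRing →ₐ[F] (S → F) := AlgHom.pi fun Q => evalAt Q.1
  have hker : RingHom.ker g = ∏ Q ∈ S, pointIdeal Q := by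
    ext f
    rw [mem_prod_pointIdeal, RingHom.mem_ker, funext_iff, Subtype.forall]
    rfl
  have hg : Function.Surjective g := by
    intro c
    obtain ⟨f, hf⟩ := Ideal.exists_forall_sub_mem_ideal
      (I := fun Q : S => pointIdeal Q.1)
      (fun _ _ h => isCoprime_pointIdeal (Subtype.coe_injective.ne h))
      (fun Q => algebraMap F _ (c Q))
    refine ⟨f, funext fun Q => ?_⟩
    have h := hf Q
    rw [mem_pointIdeal, map_sub, AlgHom.commutes] at h
    exact sub_eq_zero.mp h
  rw [← hker, (Ideal.quotientKerAlgEquivOfSurjective hg).toLinearEquiv.finrank_eq]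
  simp

omit [DecidableEq F] in
lemma finrank_quotient_span {f : E.CoordinateRing} (hf : f ≠ 0) :
    Module.finrank F (E.CoordinateRing ⧸ Ideal.span {f}) = poleOrder f :=
  finrank_quotient_span_eq_natDegree_norm (CoordinateRing.basis E) hf

omit [DecidableEq F] in
/-- For positive pole order this follows from `finrank_quotient_span`; a function of pole order zero
is constant, so that the quotient is trivial. -/
lemma finite_quotient_span {f : E.CoordinateRing} (hf : f ≠ 0) :
    Module.Finite F (E.CoordinateRing ⧸ Ideal.span {f}) := by
  rcases (poleOrder f).eq_zero_or_pos with h | h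
  · obtain ⟨p, q, rfl⟩ := CoordinateRing.exists_smul_basis_eq f
    obtain ⟨hp, hq⟩ := (poleOrder_le_iff p q 0).mp h.le
    obtain rfl : q = 0 := by
      by_contra h0
      have := hq h0
      omega
    obtain ⟨c, rfl⟩ : ∃ c, p = C c := ⟨_, eq_C_of_natDegree_eq_zero (by omega)⟩
    have hc : c ≠ 0 := by
      rintro rfl
      simp at hf
    have hu : IsUnit (C c • (1 : E.CoordinateRing) + (0 : F[X]) • CoordinateRing.mk E X) := by
      rw [zero_smul, add_zero, Algebra.smul_def, mul_one]
      exact (isUnit_C.mpr hc.isUnit).map _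
    rw [Ideal.span_singleton_eq_top.mpr hu]
    have := Ideal.Quotient.subsingleton_iff.mpr (rfl : (⊤ : Ideal E.CoordinateRing) = ⊤)
    infer_instance
  · exact Module.finite_of_finrank_pos (by rwa [finrank_quotient_span hf])

omit [DecidableEq F] in
/-- A nonzero function has no more affine zeros than its pole order at infinity. -/
lemma card_le_poleOrder {f : E.CoordinateRing} (hf : f ≠ 0) {S : Finset {Q : E.Point // Q ≠ 0}}
    (h : ∀ Q ∈ S, evalAt Q f = 0) : S.card ≤ poleOrder f := by
  rw [← finrank_quotient_prod_pointIdeal, ← finrank_quotient_span hf]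
  have hle : Ideal.span {f} ≤ ∏ Q ∈ S, pointIdeal Q := by
    rw [Ideal.span_singleton_le_iff_mem]
    exact mem_prod_pointIdeal.mpr h
  have := finite_quotient_span hf
  exact LinearMap.finrank_le_finrank_of_surjective (f := (Ideal.Quotient.factorₐ F hle).toLinearMap)
    (Ideal.Quotient.factor_surjective hle)

omit [DecidableEq F] in
/-- A nonzero function with as many affine zeros as its pole order has simple zeros and no
others. -/
lemma prod_pointIdeal_eq_span {f : E.CoordinateRing} (hf : f ≠ 0)
    {S : Finset {Q : E.Point // Q ≠ 0}} (h : ∀ Q ∈ S, evalAt Q f = 0)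
    (hS : poleOrder f ≤ S.card) : ∏ Q ∈ S, pointIdeal Q = Ideal.span {f} := by
  have hle : Ideal.span {f} ≤ ∏ Q ∈ S, pointIdeal Q := by
    rw [Ideal.span_singleton_le_iff_mem]
    exact mem_prod_pointIdeal.mpr h
  have := finite_quotient_span hf
  let π := (Ideal.Quotient.factorₐ F hle).toLinearMap
  have hsurj : Function.Surjective π := Ideal.Quotient.factor_surjective hle
  have hfin : Module.finrank F (E.CoordinateRing ⧸ Ideal.span {f}) =
      Module.finrank F (E.CoordinateRing ⧸ ∏ Q ∈ S, pointIdeal Q) := by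
    rw [finrank_quotient_prod_pointIdeal, finrank_quotient_span hf]
    exact hS.antisymm (card_le_poleOrder hf h)
  have := Module.Finite.of_surjective π hsurj
  have hinj := (LinearMap.injective_iff_surjective_of_finrank_eq_finrank hfin).mpr hsurj
  refine hle.antisymm' fun g hg => ?_
  rw [← Ideal.Quotient.eq_zero_iff_mem] at hg ⊢
  exact hinj (hg.trans (map_zero π).symm)

/-- For a set `S` of `k` affine rational points, some function in `L(kO)` has exactly `S` as its
set of rational zeros if and only if `S` sums to zero. -/
lemma exists_zeros_eq_iff_sum_eq_zero {S : Finset {Q : E.Point // Q ≠ 0}} {k : ℕ}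
    (hS : S.card = k) :
    (∃ f : E.CoordinateRing, f ≠ 0 ∧ poleOrder f ≤ k ∧ ∀ Q, evalAt Q f = 0 ↔ Q ∈ S) ↔
      ∑ Q ∈ S, (Q : E.Point) = 0 := by
  rw [sum_eq_zero_iff]
  constructor
  · rintro ⟨f, hf, hk, hfS⟩
    exact ⟨f, hf, prod_pointIdeal_eq_span hf (fun Q hQ => (hfS Q).mpr hQ) (hS ▸ hk)⟩
  · rintro ⟨f, hf, hprod⟩
    refine ⟨f, hf, ?_, fun Q => ⟨fun hQ => ?_, ?_⟩⟩
    · rw [← finrank_quotient_span hf, ← hprod, finrank_quotient_prod_pointIdeal, hS]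
    · rw [← mem_pointIdeal, ← Ideal.span_singleton_le_iff_mem, ← hprod,
        Ideal.IsPrime.prod_le inferInstance] at hQ
      obtain ⟨Q', hQ', hle⟩ := hQ
      have := Ideal.IsMaximal.eq_of_le (inferInstance : (pointIdeal Q').IsMaximal)
        (Ideal.IsPrime.ne_top inferInstance) hle
      rwa [← pointIdeal_injective this]
    · have : f ∈ ∏ Q ∈ S, pointIdeal Q := hprod ▸ Ideal.mem_span_singleton_self f
      exact fun hQ => mem_prod_pointIdeal.mp this Q hQ

end Evaluation

section Value

variable {F : Type*} [Field F] {E : WeierstrassCurve.Affine F}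

lemma pointIdeal_ne_bot (Q : {Q : E.Point // Q ≠ 0}) : pointIdeal Q ≠ ⊥ := by
  obtain ⟨_ | ⟨x, y, h⟩, h0⟩ := Q
  · exact absurd rfl h0
  · rw [pointIdeal_some]
    intro hbot
    have hx : CoordinateRing.XClass E x ∈ CoordinateRing.XYIdeal E x (C y) :=
      Ideal.subset_span (Set.mem_insert _ _)
    rw [hbot, Ideal.mem_bot] at hx
    exact CoordinateRing.XClass_ne_zero x hx

lemma xFun_sub (x : F) : xFun E - algebraMap F E.FunctionField x =
    algebraMap E.CoordinateRing E.FunctionField (CoordinateRing.XClass E x) := by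
  rw [CoordinateRing.XClass, C_sub, map_sub, map_sub]
  rfl

lemma yFun_sub (y : F) : yFun E - algebraMap F E.FunctionField y =
    algebraMap E.CoordinateRing E.FunctionField (CoordinateRing.YClass E (C y)) := by
  rw [CoordinateRing.YClass, map_sub, map_sub]
  rfl

variable [E.IsElliptic] [E.IsShortNF]

/-- The place at an affine rational point. -/
noncomputable def placeAtPoint (Q : {Q : E.Point // Q ≠ 0}) : Place F E.FunctionField :=
  placeOfPrime ⟨pointIdeal Q, inferInstance, pointIdeal_ne_bot Q⟩

lemma placeAtPoint_lt_one_iff (Q : {Q : E.Point // Q ≠ 0}) (f : E.CoordinateRing) :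
    (placeAtPoint Q).val (algebraMap E.CoordinateRing E.FunctionField f) < 1 ↔
      f ∈ pointIdeal Q :=
  IsDedekindDomain.HeightOneSpectrum.valuation_lt_one_iff_mem _ _

lemma isPlaceAt_placeAtPoint (Q : {Q : E.Point // Q ≠ 0}) : IsPlaceAt (placeAtPoint Q) Q.1 := by
  obtain ⟨_ | ⟨x, y, h⟩, h0⟩ := Q
  · exact absurd rfl h0
  · rw [IsPlaceAt, xFun_sub, yFun_sub, placeAtPoint_lt_one_iff, placeAtPoint_lt_one_iff,
      pointIdeal_some]
    exact ⟨Ideal.subset_span (Set.mem_insert _ _),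
      Ideal.subset_span (Set.mem_insert_of_mem _ rfl)⟩

omit [E.IsElliptic] in
lemma val_lt_one_of_mem_pointIdeal {v : Place F E.FunctionField} {Q : {Q : E.Point // Q ≠ 0}}
    (hv : IsPlaceAt v Q.1) {f : E.CoordinateRing} (hf : f ∈ pointIdeal Q) :
    v.val (algebraMap E.CoordinateRing E.FunctionField f) < 1 := by
  obtain ⟨_ | ⟨x, y, h⟩, h0⟩ := Q
  · exact absurd rfl h0
  · have hO : ¬ IsPlaceAt v (0 : E.Point) := by
      rw [isPlaceAt_zero_iff, not_lt, ← sub_add_cancel (xFun E) (algebraMap F _ x)]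
      exact (v.val.map_add _ _).trans (max_le hv.1.le (v.val_algebraMap_le_one x))
    have hint := val_le_one_of_not_isPlaceAt_zero hO
    rw [IsPlaceAt, xFun_sub, yFun_sub] at hv
    rw [pointIdeal_some, CoordinateRing.XYIdeal, Ideal.mem_span_pair] at hf
    obtain ⟨a, b, rfl⟩ := hf
    rw [map_add, map_mul, map_mul]
    refine (v.val.map_add _ _).trans_lt (max_lt ?_ ?_)
    · rw [map_mul]
      exact (mul_le_of_le_one_left' (hint a)).trans_lt hv.1
    · rw [map_mul]
      exact (mul_le_of_le_one_left' (hint b)).trans_lt hv.2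

lemma hasValueAt_iff (Q : {Q : E.Point // Q ≠ 0}) (f : E.CoordinateRing) (c : F) :
    HasValueAt (algebraMap E.CoordinateRing E.FunctionField f) Q.1 c ↔ evalAt Q f = c := by
  have hsub : algebraMap E.CoordinateRing E.FunctionField f - algebraMap F E.FunctionField c =
      algebraMap E.CoordinateRing E.FunctionField (f - algebraMap F _ c) := by
    rw [map_sub, ← IsScalarTower.algebraMap_apply]
  constructor
  · intro h
    have h1 := h _ (isPlaceAt_placeAtPoint Q)
    rw [hsub, placeAtPoint_lt_one_iff, mem_pointIdeal, map_sub, AlgHom.commutes] at h1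
    exact sub_eq_zero.mp h1
  · rintro rfl v hv
    rw [hsub]
    exact val_lt_one_of_mem_pointIdeal hv (sub_evalAt_mem_pointIdeal Q f)

lemma mem_code_iff {ι : Type*} (P : ι → {Q : E.Point // Q ≠ 0}) (k : ℕ) (c : ι → F) :
    c ∈ code (fun i => (P i : E.Point)) (k • pointDivisor (0 : E.Point)) ↔
      ∃ f : E.CoordinateRing, poleOrder f ≤ k ∧ ∀ i, c i = evalAt (P i) f := by
  constructor
  · rintro ⟨f, hf, hc⟩
    obtain ⟨r, hr, rfl⟩ := (mem_riemannRochSpace_iff k f).mp hf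
    exact ⟨r, hr, fun i => ((hasValueAt_iff _ _ _).mp (hc i)).symm⟩
  · rintro ⟨r, hr, hc⟩
    exact ⟨_, (mem_riemannRochSpace_iff k _).mpr ⟨r, hr, rfl⟩,
      fun i => (hasValueAt_iff _ _ _).mpr (hc i).symm⟩

end Value
end EllipticCode

/-! ### Transitive block families and sums in a plane over a prime field -/

section Design

/-- A nonempty family of nonempty blocks of equal size, invariant under a transitive set of
permutations of the points, is a `1`-design. -/
lemma exists_isDesign_one_of_transitive {α : Type*} [Fintype α] {𝓑 : Set (Finset α)} {w : ℕ}
    (hw : 0 < w) (hcard : ∀ B ∈ 𝓑, B.card = w) (hne : 𝓑.Nonempty)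
    (h : ∀ i j : α, ∃ τ : Equiv.Perm α, τ i = j ∧ ∀ B ∈ 𝓑, B.map τ.toEmbedding ∈ 𝓑) :
    ∃ lam, IsDesign 𝓑 1 (Fintype.card α) w lam := by
  have hle (i j : α) : {B ∈ 𝓑 | {i} ⊆ B}.ncard ≤ {B ∈ 𝓑 | {j} ⊆ B}.ncard := by
    obtain ⟨τ, rfl, hτ⟩ := h i j
    refine Set.ncard_le_ncard_of_injOn (fun B => B.map τ.toEmbedding) ?_
      (Finset.map_injective _).injOn (Set.toFinite _)
    rintro B ⟨hB, hi⟩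
    refine ⟨hτ B hB, ?_⟩
    rw [Finset.singleton_subset_iff] at hi ⊢
    exact Finset.mem_map_of_mem _ hi
  obtain ⟨B, hB⟩ := hne
  obtain ⟨i, hi⟩ : B.Nonempty := Finset.card_pos.mp (hw.trans_eq (hcard B hB).symm)
  refine ⟨{B ∈ 𝓑 | {i} ⊆ B}.ncard, rfl, hcard, fun T hT => ?_, ?_⟩
  · obtain ⟨j, rfl⟩ := Finset.card_eq_one.mp hT
    exact (hle j i).antisymm (hle i j)
  · exact (Set.ncard_pos (Set.toFinite _)).mpr ⟨B, hB, Finset.singleton_subset_iff.mpr hi⟩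

/-- The automorphisms of a vector space act transitively on the nonzero vectors. -/
lemma exists_linearEquiv_apply_eq {K V : Type*} [Field K] [AddCommGroup V] [Module K V] {u w : V}
    (hu : u ≠ 0) (hw : w ≠ 0) : ∃ σ : V ≃ₗ[K] V, σ u = w := by
  obtain ⟨σ, hσ⟩ := Submodule.exists_linearEquiv_restrict_eq
    ((LinearEquiv.toSpanNonzeroSingleton K V u hu).symm.trans
      (LinearEquiv.toSpanNonzeroSingleton K V w hw))
  refine ⟨σ, ?_⟩
  have h := hσ ⟨u, Submodule.mem_span_singleton_self u⟩
  have h1 : (⟨u, Submodule.mem_span_singleton_self u⟩ : Submodule.span K {u}) =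
      LinearEquiv.toSpanNonzeroSingleton K V u hu 1 := by
    rw [LinearEquiv.toSpanNonzeroSingleton_one]
  rw [← h, LinearEquiv.trans_apply, h1, LinearEquiv.symm_apply_apply,
    LinearEquiv.toSpanNonzeroSingleton_one]

/-- In the plane over `𝔽_p`, `p` odd, the union of `m` cosets of a line is a set of `p m` vectors
with sum zero; it does not contain the zero vector if it does not contain the line itself. -/
lemma exists_finset_sum_eq_zero {p m : ℕ} [Fact p.Prime] (hp2 : p ≠ 2) (hm : m < p) :
    ∃ A : Finset (ZMod p × ZMod p), 0 ∉ A ∧ A.card = p * m ∧ ∑ v ∈ A, v = 0 := by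
  have hp : p.Prime := Fact.out
  obtain ⟨A, hA, hAm⟩ := Finset.exists_subset_card_eq
    (s := (Finset.univ : Finset (ZMod p)).erase 0) (n := m) (by
      rw [Finset.card_erase_of_mem (Finset.mem_univ _), Finset.card_univ, ZMod.card]
      omega)
  have hsum : ∑ b : ZMod p, b = 0 := by
    have h := FiniteField.sum_pow_lt_card_sub_one (ZMod p) 1 (by
      have := hp.two_le
      rw [ZMod.card]
      omega)
    simpa using h
  refine ⟨A ×ˢ Finset.univ, ?_, ?_, ?_⟩
  · intro h
    exact Finset.notMem_erase 0 _ (hA (Finset.mem_product.mp h).1)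
  · rw [Finset.card_product, hAm, Finset.card_univ, ZMod.card, mul_comm]
  · rw [Finset.sum_product]
    refine Prod.ext ?_ ?_
    · simp [Prod.fst_sum]
    · simp [Prod.snd_sum, hsum]

end Design

/-! ### Supports of the minimum-weight words of a linear code -/

namespace LinearCode

variable {F ι : Type*} [Field F] [DecidableEq F] [Fintype ι]

lemma mem_support {c : ι → F} {i : ι} : i ∈ support c ↔ c i ≠ 0 := Finset.mem_filter_univ i

lemma hammingNorm_eq_card_support (c : ι → F) : hammingNorm c = (support c).card := rfl

lemma minDist_eq {C : Submodule F (ι → F)} {w : ℕ} (hw : 0 < w)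
    (hle : ∀ c ∈ C, c ≠ 0 → w ≤ hammingNorm c) (hne : (supports C w).Nonempty) :
    minDist C = w := by
  obtain ⟨B, c, hc, hcw, -⟩ := hne
  have hc0 : c ≠ 0 := by
    rintro rfl
    rw [hammingNorm_zero] at hcw
    omega
  refine le_antisymm (Nat.sInf_le ⟨c, hc, hc0, hcw⟩) (le_csInf ⟨w, c, hc, hc0, hcw⟩ ?_)
  rintro _ ⟨c', hc', hc0', rfl⟩
  exact hle c' hc' hc0'

lemma card_of_mem_supports {C : Submodule F (ι → F)} {w : ℕ} {B : Finset ι}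
    (hB : B ∈ supports C w) : B.card = w := by
  obtain ⟨c, -, hcw, rfl⟩ := hB
  exact hcw

/-- The supports of the codewords of minimum weight `w` form a `1`-design if they are permuted by
a transitive set of permutations of the coordinates. -/
lemma supportsDesign_one {C : Submodule F (ι → F)} {w : ℕ} (hw : 0 < w)
    (hle : ∀ c ∈ C, c ≠ 0 → w ≤ hammingNorm c) (hne : (supports C w).Nonempty)
    (h : ∀ i j : ι, ∃ τ : Equiv.Perm ι, τ i = j ∧
      ∀ B ∈ supports C w, B.map τ.toEmbedding ∈ supports C w) :
    SupportsDesign C 1 := by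
  rw [SupportsDesign, minDist_eq hw hle hne]
  exact exists_isDesign_one_of_transitive hw (fun B hB => card_of_mem_supports hB) hne h

end LinearCode

/-! ### Dimension and supports of the elliptic code -/

namespace EllipticCode

open LinearCode

section Dimension

variable {F : Type*} [Field F] {E : WeierstrassCurve.Affine F}

lemma mem_degreeLT_iff_of_ne_zero {q : F[X]} (n : ℕ) (hq : q ≠ 0) :
    q ∈ degreeLT F n ↔ q.natDegree < n := by
  rw [mem_degreeLT, natDegree_lt_iff_degree_lt hq]

/-- For `k ≥ 1`, the functions `p + q y` of pole order at most `k` are those with `p` among the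
polynomials of degree less than `k / 2 + 1` and `q` among those of degree less than
`(k - 1) / 2`. -/
lemma poleOrder_le_iff_mem_degreeLT {k : ℕ} (hk : 1 ≤ k) (p q : F[X]) :
    poleOrder (p • 1 + q • CoordinateRing.mk E X) ≤ k ↔
      p ∈ degreeLT F (k / 2 + 1) ∧ q ∈ degreeLT F ((k - 1) / 2) := by
  rw [poleOrder_le_iff]
  refine and_congr ?_ ?_
  · by_cases hp : p = 0
    · simp [hp]
    · rw [mem_degreeLT_iff_of_ne_zero _ hp]
      omega
  · by_cases hq : q = 0
    · simp [hq]
    · rw [mem_degreeLT_iff_of_ne_zero _ hq]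
      simp only [ne_eq, hq, not_false_eq_true, forall_const]
      omega

/-- The evaluation of the functions `p + q y`, for `p` and `q` of bounded degree, at given affine
rational points. -/
noncomputable def evalMap {ι : Type*} (P : ι → {Q : E.Point // Q ≠ 0}) (a b : ℕ) :
    (degreeLT F a × degreeLT F b) →ₗ[F] (ι → F) :=
  (LinearMap.pi fun i => (evalAt (P i)).toLinearMap) ∘ₗ
    (((LinearMap.toSpanSingleton F[X] E.CoordinateRing 1).restrictScalars F ∘ₗ
      (degreeLT F a).subtype).coprod
    ((LinearMap.toSpanSingleton F[X] E.CoordinateRing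
      (CoordinateRing.mk E X)).restrictScalars F ∘ₗ (degreeLT F b).subtype))

lemma finrank_degreeLT (n : ℕ) : Module.finrank F (degreeLT F n) = n := by
  rw [(degreeLTEquiv F n).finrank_eq, Module.finrank_fin_fun]

end Dimension

section Code

variable {F : Type*} [Field F] {E : WeierstrassCurve.Affine F}
variable {ι : Type*} [Fintype ι] (P : ι ≃ {Q : E.Point // Q ≠ 0})

include P in
lemma eq_zero_of_forall_evalAt_eq_zero {k : ℕ} (hk : k < Fintype.card ι) {f : E.CoordinateRing}
    (hf : poleOrder f ≤ k) (h : ∀ i, evalAt (P i) f = 0) : f = 0 := by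
  by_contra hf0
  have hcard := card_le_poleOrder hf0 (S := Finset.univ.map P.toEmbedding) (by
    intro Q hQ
    obtain ⟨i, -, rfl⟩ := Finset.mem_map.mp hQ
    exact h i)
  rw [Finset.card_map, Finset.card_univ] at hcard
  omega

variable [E.IsElliptic] [E.IsShortNF]

/-- The dimension is `k`: the functions in `L(kO)` are determined by their values, as they have at
most `k` zeros. -/
lemma finrank_code {k : ℕ} (hk1 : 1 ≤ k) (hk : k < Fintype.card ι) :
    Module.finrank F
      (code (fun i => (P i : E.Point)) (k • pointDivisor (0 : E.Point))) = k := by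
  have hrange : code (fun i => (P i : E.Point)) (k • pointDivisor (0 : E.Point)) =
      LinearMap.range (evalMap P (k / 2 + 1) ((k - 1) / 2)) := by
    ext c
    rw [mem_code_iff, LinearMap.mem_range]
    constructor
    · rintro ⟨f, hf, hc⟩
      obtain ⟨p, q, rfl⟩ := CoordinateRing.exists_smul_basis_eq f
      obtain ⟨hp, hq⟩ := (poleOrder_le_iff_mem_degreeLT hk1 p q).mp hf
      exact ⟨(⟨p, hp⟩, ⟨q, hq⟩), funext fun i => (hc i).symm⟩
    · rintro ⟨⟨⟨p, hp⟩, ⟨q, hq⟩⟩, rfl⟩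
      exact ⟨_, (poleOrder_le_iff_mem_degreeLT hk1 p q).mpr ⟨hp, hq⟩, fun i => rfl⟩
  have hinj : Function.Injective (evalMap P (k / 2 + 1) ((k - 1) / 2)) := by
    refine (injective_iff_map_eq_zero _).mpr ?_
    rintro ⟨⟨p, hp⟩, ⟨q, hq⟩⟩ h
    have h0 := eq_zero_of_forall_evalAt_eq_zero P hk
      ((poleOrder_le_iff_mem_degreeLT hk1 p q).mpr ⟨hp, hq⟩) fun i => congrFun h i
    obtain ⟨rfl, rfl⟩ := CoordinateRing.smul_basis_eq_zero h0
    rfl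
  rw [hrange, LinearMap.finrank_range_of_inj hinj]
  have (n : ℕ) : Module.Finite F (degreeLT F n) := .equiv (degreeLTEquiv F n).symm
  rw [Module.finrank_prod, finrank_degreeLT, finrank_degreeLT]
  omega

variable [DecidableEq F]

lemma sub_le_hammingNorm {k : ℕ} {c : ι → F}
    (hc : c ∈ code (fun i => (P i : E.Point)) (k • pointDivisor (0 : E.Point))) (hc0 : c ≠ 0) :
    Fintype.card ι - k ≤ hammingNorm c := by
  classical
  obtain ⟨f, hf, hcf⟩ := (mem_code_iff P k c).mp hc
  have hf0 : f ≠ 0 := by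
    rintro rfl
    exact hc0 (funext fun i => by rw [hcf, map_zero]; rfl)
  have hcard := card_le_poleOrder hf0 (S := (support c)ᶜ.map P.toEmbedding) (by
    intro Q hQ
    obtain ⟨i, hi, rfl⟩ := Finset.mem_map.mp hQ
    rw [Finset.mem_compl, mem_support, not_not, hcf] at hi
    exact hi)
  rw [Finset.card_map, Finset.card_compl] at hcard
  rw [hammingNorm_eq_card_support]
  omega

/-- The supports of the codewords of weight `n - k` are the complements of the sets of `k` points
with sum zero. -/
lemma mem_supports_iff [DecidableEq ι] {k : ℕ} (hk : k < Fintype.card ι) (B : Finset ι) :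
    B ∈ supports (code (fun i => (P i : E.Point)) (k • pointDivisor (0 : E.Point)))
      (Fintype.card ι - k) ↔ Bᶜ.card = k ∧ ∑ i ∈ Bᶜ, (P i : E.Point) = 0 := by
  have hcard : B.card = Fintype.card ι - k ↔ Bᶜ.card = k := by
    have := Finset.card_le_univ B
    rw [Finset.card_compl]
    omega
  have hsum : ∑ i ∈ Bᶜ, (P i : E.Point) = ∑ Q ∈ Bᶜ.map P.toEmbedding, (Q : E.Point) := by
    rw [Finset.sum_map]
    rfl
  have hmem (i : ι) : P i ∈ Bᶜ.map P.toEmbedding ↔ i ∉ B := by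
    rw [← Finset.mem_compl]
    exact Finset.mem_map' P.toEmbedding
  constructor
  · rintro ⟨c, hc, hcw, rfl⟩
    have hB := hcard.mp hcw
    refine ⟨hB, ?_⟩
    rw [hsum, ← exists_zeros_eq_iff_sum_eq_zero (k := k) (by rw [Finset.card_map, hB])]
    obtain ⟨f, hf, hcf⟩ := (mem_code_iff P k c).mp hc
    refine ⟨f, ?_, hf, fun Q => ?_⟩
    · rintro rfl
      have : c = 0 := funext fun i => by rw [hcf, map_zero]; rfl
      rw [this, hammingNorm_zero] at hcw
      omega
    · obtain ⟨i, rfl⟩ := P.surjective Q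
      rw [hmem, mem_support, not_not, hcf]
  · rintro ⟨hB, h⟩
    rw [hsum, ← exists_zeros_eq_iff_sum_eq_zero (k := k) (by rw [Finset.card_map, hB])] at h
    obtain ⟨f, hf0, hf, hfB⟩ := h
    have hsupp : support (fun i => evalAt (P i) f) = B := by
      ext i
      rw [mem_support, ne_eq, hfB, hmem, not_not]
    refine ⟨fun i => evalAt (P i) f, (mem_code_iff P k _).mpr ⟨f, hf, fun i => rfl⟩, ?_, hsupp⟩
    rw [hammingNorm_eq_card_support, hsupp, hcard, hB]

/-- Automorphisms of the group of rational points permute the supports of the codewords of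
weight `n - k`. -/
lemma exists_perm_map_mem_supports {p k : ℕ} [Fact p.Prime] (e : E.Point ≃+ ZMod p × ZMod p)
    (hk : k < Fintype.card ι) (i j : ι) : ∃ τ : Equiv.Perm ι, τ i = j ∧
      ∀ B ∈ supports (code (fun i => (P i : E.Point)) (k • pointDivisor (0 : E.Point)))
        (Fintype.card ι - k), B.map τ.toEmbedding ∈
          supports (code (fun i => (P i : E.Point)) (k • pointDivisor (0 : E.Point)))
            (Fintype.card ι - k) := by
  classical
  have he (l : ι) : e (P l) ≠ 0 := (map_ne_zero_iff e e.injective).mpr (P l).2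
  obtain ⟨σ, hσ⟩ := exists_linearEquiv_apply_eq (K := ZMod p) (he i) (he j)
  let ρ : E.Point ≃+ E.Point := (e.trans σ.toAddEquiv).trans e.symm
  have hρ (Q : E.Point) : Q ≠ 0 ↔ ρ Q ≠ 0 := (map_ne_zero_iff ρ ρ.injective).symm
  let τ : Equiv.Perm ι := (P.trans (ρ.toEquiv.subtypeEquiv hρ)).trans P.symm
  have hτ (l : ι) : (P (τ l) : E.Point) = ρ (P l) := by
    simp [τ]
  refine ⟨τ, ?_, fun B hB => ?_⟩
  · apply P.injective
    apply Subtype.ext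
    rw [hτ]
    change e.symm (σ (e (P i))) = _
    rw [hσ, AddEquiv.symm_apply_apply]
  · rw [mem_supports_iff P hk] at hB ⊢
    have hcompl : (B.map τ.toEmbedding)ᶜ = Bᶜ.map τ.toEmbedding := by
      ext l
      obtain ⟨l, rfl⟩ := τ.surjective l
      simp
    rw [hcompl, Finset.card_map, Finset.sum_map]
    refine ⟨hB.1, ?_⟩
    simp only [Equiv.coe_toEmbedding, hτ]
    rw [← map_sum, hB.2, map_zero]

lemma supports_nonempty {p m : ℕ} [Fact p.Prime] (hp2 : p ≠ 2) (hm : m < p)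
    (e : E.Point ≃+ ZMod p × ZMod p) (hk : p * m < Fintype.card ι) :
    (supports (code (fun i => (P i : E.Point)) ((p * m) • pointDivisor (0 : E.Point)))
      (Fintype.card ι - p * m)).Nonempty := by
  classical
  obtain ⟨A, hA0, hA, hsum⟩ := exists_finset_sum_eq_zero hp2 hm
  have hinj : Function.Injective fun i => e (P i) :=
    e.injective.comp (Subtype.val_injective.comp P.injective)
  have himage : ({i | e (P i) ∈ A} : Finset ι).image (fun i => e (P i)) = A := by
    ext v
    rw [Finset.mem_image]
    constructor
    · rintro ⟨i, hi, rfl⟩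
      simpa using hi
    · intro hv
      have hv0 : e.symm v ≠ 0 := by
        rw [ne_eq, map_eq_zero_iff e.symm e.symm.injective]
        rintro rfl
        exact hA0 hv
      obtain ⟨i, hi⟩ := P.surjective ⟨e.symm v, hv0⟩
      have hiv : e (P i) = v := by rw [hi, AddEquiv.apply_symm_apply]
      exact ⟨i, by simpa [hiv] using hv, hiv⟩
  refine ⟨({i | e (P i) ∈ A} : Finset ι)ᶜ, ?_⟩
  rw [mem_supports_iff P hk, compl_compl]
  constructor
  · rw [← hA, ← himage, Finset.card_image_of_injective _ hinj, himage]
  · apply e.injective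
    rw [map_zero, map_sum, ← hsum, ← himage, Finset.sum_image hinj.injOn, himage]

/-- In the case `p = 2` the code is an MDS code of length `3` and dimension `2`: a codeword of
weight `1` would come from two distinct points of order `2` with sum zero. -/
lemma supportsDesign_of_two (e : E.Point ≃+ ZMod 2 × ZMod 2) (hι : Fintype.card ι = 3) :
    SupportsDesign (code (fun i => (P i : E.Point)) (2 • pointDivisor (0 : E.Point))) 1 := by
  classical
  set C := code (fun i => (P i : E.Point)) (2 • pointDivisor (0 : E.Point)) with hC
  have hdim : Module.finrank F C = 2 := finrank_code P one_le_two (by omega)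
  have hle : ∀ c ∈ C, c ≠ 0 → 2 ≤ hammingNorm c := by
    intro c hc hc0
    have h1 := sub_le_hammingNorm P hc hc0
    rw [hι] at h1
    by_contra hlt
    have hmem : support c ∈ supports C (Fintype.card ι - 2) := ⟨c, hc, by omega, rfl⟩
    rw [mem_supports_iff P (by omega)] at hmem
    obtain ⟨hcard, hsum⟩ := hmem
    obtain ⟨i, j, hij, hs⟩ := Finset.card_eq_two.mp hcard
    rw [hs, Finset.sum_pair hij] at hsum
    apply hij
    apply P.injective
    apply Subtype.ext
    apply e.injective
    have h := congrArg e hsum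
    rw [map_add, map_zero] at h
    rw [eq_neg_of_add_eq_zero_left h]
    exact Prod.ext (ZMod.neg_eq_self_mod_two _) (ZMod.neg_eq_self_mod_two _)
  have hsupp : supports C 2 = {B | B.card = 2} := by
    ext B
    refine ⟨card_of_mem_supports, fun hB => ?_⟩
    rw [Set.mem_ofPred_eq] at hB
    have hBc : Bᶜ.card = 1 := by
      rw [Finset.card_compl]
      omega
    obtain ⟨i, hi⟩ := Finset.card_eq_one.mp hBc
    obtain ⟨c, hci, hc0⟩ := Submodule.exists_mem_ne_zero_of_ne_bot
      (LinearMap.ker_ne_bot_of_finrank_lt (f := LinearMap.proj i ∘ₗ C.subtype)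
        (by rw [hdim, Module.finrank_self]; exact one_lt_two))
    have hsub : support c.1 ⊆ B := by
      intro j hj
      by_contra hjB
      rw [← Finset.mem_compl, hi, Finset.mem_singleton] at hjB
      subst hjB
      rw [mem_support] at hj
      exact hj hci
    have hw := hle c.1 c.2 (by simpa using hc0)
    have hs : support c.1 = B := Finset.eq_of_subset_of_card_le hsub (hB.trans_le hw)
    exact ⟨c.1, c.2, by rw [hammingNorm_eq_card_support, hs, hB], hs⟩
  refine supportsDesign_one two_pos hle ?_ fun i j => ⟨Equiv.swap i j,
    Equiv.swap_apply_left i j, ?_⟩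
  · rw [hsupp]
    obtain ⟨B, -, hB⟩ := Finset.exists_subset_card_eq (s := (Finset.univ : Finset ι)) (n := 2)
      (by rw [Finset.card_univ]; omega)
    exact ⟨B, hB⟩
  · rw [hsupp]
    intro B hB
    rw [Set.mem_ofPred_eq, Finset.card_map]
    exact hB

end Code

end EllipticCode

end

theorem corollary6p4 {F : Type*} [Field F] [Finite F] [DecidableEq F]
    (hchar2 : ringChar F ≠ 2) (hchar3 : ringChar F ≠ 3)
    (E : WeierstrassCurve.Affine F) [E.IsElliptic] [E.IsShortNF]
    (p k : ℕ) (hp : p.Prime) (hE : Nonempty (E.Point ≃+ ZMod p × ZMod p))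
    (hk1 : 1 ≤ k) (hk2 : k ≤ p ^ 2 - 2) (hpk : p ∣ k)
    (P : Fin (p ^ 2 - 1) ≃ {Q : E.Point // Q ≠ 0})
    (C : Submodule F (Fin (p ^ 2 - 1) → F))
    (hC : C = EllipticCode.code (fun i => (P i : E.Point))
      (k • EllipticCode.pointDivisor (0 : E.Point))) :
    Module.finrank F C = k ∧ (p ≠ 2 → LinearCode.minDist C = p ^ 2 - k - 1) ∧
      LinearCode.SupportsDesign C 1 := by
  have : Fact p.Prime := ⟨hp⟩
  obtain ⟨e⟩ := hE
  have hcard : Fintype.card (Fin (p ^ 2 - 1)) = p ^ 2 - 1 := Fintype.card_fin _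
  have hk : k < Fintype.card (Fin (p ^ 2 - 1)) := by omega
  obtain ⟨m, rfl⟩ := hpk
  have hm : m < p := by
    refine lt_of_mul_lt_mul_left (a := p) ?_ (Nat.zero_le p)
    rw [← sq]
    omega
  subst hC
  have hle := fun c hc hc0 => EllipticCode.sub_le_hammingNorm (k := p * m) P (c := c) hc hc0
  refine ⟨EllipticCode.finrank_code P hk1 hk, fun hp2 => ?_, ?_⟩
  · rw [LinearCode.minDist_eq (by omega) hle (EllipticCode.supports_nonempty P hp2 hm e hk)]
    omega
  · by_cases hp2 : p = 2
    · subst hp2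
      obtain rfl : m = 1 := by omega
      exact EllipticCode.supportsDesign_of_two P e hcard
    · exact LinearCode.supportsDesign_one (by omega) hle
        (EllipticCode.supports_nonempty P hp2 hm e hk)
        (EllipticCode.exists_perm_map_mem_supports P e hk)
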